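/- Let $\mathbb H$ be a separable real Hilbert space and let $d,n,L_1,\dots,L_d\in\mathbb N$. For $1\le j\le d$ let $D_j\subset\mathbb R^{L_j}$ be a compact set of positive Lebesgue measure $|D_j|$, let $h_j>0$, and let $K_j:[0,\infty)\to[0,\infty)$ be continuous, positive on $[0,1)$ and zero on $[1,\infty)$. Put $D=\prod_{j=1}^d D_j$. Let $(\tilde\xi^i,\tilde Y^i)$, $1\le i\le n$, be given points of $\prod_{j=1}^d\mathbb R^{L_j}\times\mathbb H$ with $\tilde\xi^i=(\tilde\xi^i_1,\dots,\tilde\xi^i_d)$ and with $\tilde\xi^i\in D$ for at least one $i$. Let $\|\cdot\|$ denote the Euclidean norms and the norm of $\mathbb H$, and let $B_j(x_j,R)$ be the open Euclidean ball in $\mathbb R^{L_j}$ with centre $x_j$ and radius $R$. Define $$K_{h_j}(x_j,u_j)=\frac{h_j^{-L_j}K_j(\|x_j-u_j\|/h_j)}{\int_{D_j}h_j^{-L_j}K_j(\|t_j-u_j\|/h_j)\,dt_j}$$ if the denominator is nonzero, and $K_{h_j}(x_j,u_j)=|D_j|^{-1}$ otherwise. With $I_i=1$ if $\tilde\xi^i\in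 D$ and $I_i=0$ otherwise, put $\hat p_0=n^{-1}\sum_{i=1}^n I_i$, $\hat f_0=(\hat p_0 n)^{-1}\sum_{i=1}^n I_i\tilde Y^i$, $$\hat p(x)=\frac1{\hat p_0n}\sum_{i=1}^n I_i\prod_{j=1}^dK_{h_j}(x_j,\tilde\xi^i_j),\qquad \hat p_j(x_j)=\frac1{\hat p_0n}\sum_{i=1}^n I_iK_{h_j}(x_j,\tilde\xi^i_j),$$ $$\hat p_{jk}(x_j,x_k)=\frac1{\hat p_0n}\sum_{i=1}^n I_iK_{h_j}(x_j,\tilde\xi^i_j)K_{h_k}(x_k,\tilde\xi^i_k),\qquad \hat m_j(x_j)=\frac1{\hat p_j(x_j)\,\hat p_0n}\sum_{i=1}^n I_iK_{h_j}(x_j,\tilde\xi^i_j)\tilde Y^i,$$ and let $\hat P$ be the measure on $D$ with density $\hat p$ with respect to Lebesgue measure. A tuple of maps $\hat f_j:D_j\to\mathbb H$, $1\le j\le d$, is called a solution if for all $1\le j\le d$ and all $x_j\in D_j$ the following Bochner integrals exist and $$\hat f_j(x_j)=\hat m_j(x_j)-\hat f_0-\sum_{k\ne j}\int_{D_k}\frac{\hat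 p_{jk}(x_j,x_k)}{\hat p_j(x_j)}\,\hat f_k(x_k)\,dx_k .\tag{1}$$ The constraints are $$\int_{D_j}\hat p_j(x_j)\hat f_j(x_j)\,dx_j=0,\qquad\int_{D_j}\|\hat f_j(x_j)\|^2\hat p_j(x_j)\,dx_j<\infty,\qquad1\le j\le d.\tag{2}$$ Assume condition (A): for each $1\le j\le d$ and each $x_j\in D_j$ there is an $i$ with $\tilde\xi^i\in D$ and $\tilde\xi^i_j\in B_j(x_j,h_j)$. Then the following hold. (i) There exists a solution of (1) that satisfies (2). (ii) If $(\hat f_j)$ and $(\hat f^\star_j)$ are solutions of (1), then $\sum_{j=1}^d\hat f_j(x_j)=\sum_{j=1}^d\hat f^\star_j(x_j)$ for $\hat P$-almost every $x\in D$. (iii) If $(\hat f_j)$ and $(\hat f^\star_j)$ are solutions of (1) that satisfy (2), and if for each $x\in D$ there is an $i$ with $\tilde\xi^i\in D\cap\prod_{j=1}^dB_j(x_j,h_j)$, then for every $1\le j\le d$, $\hat f_j=\hat f^\star_j$ Lebesgue-almost everywhere on $D_j$. -/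

import Mathlib

open MeasureTheory

noncomputable section

namespace SBF

variable {d n : ℕ} {L : Fin d → ℕ}
variable {H : Type*} [NormedAddCommGroup H] [InnerProductSpace ℝ H]

/-- The estimation domain: the product of the sets `D j ⊆ ℝ^(L j)`. -/
def domain (D : ∀ j, Set (EuclideanSpace ℝ (Fin (L j)))) :
    Set (∀ j, EuclideanSpace ℝ (Fin (L j))) :=
  Set.univ.pi D

/-- The indicator that an observation `z` lies in the estimation domain. -/
def ind (D : ∀ j, Set (EuclideanSpace ℝ (Fin (L j))))
    (z : ∀ j, EuclideanSpace ℝ (Fin (L j))) : ℝ :=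
  (domain D).indicator (fun _ => (1 : ℝ)) z

/-- The normalized kernel on `D₀ ⊆ ℝ^m` with bandwidth `b` and profile `K`. -/
def kernel {m : ℕ} (D₀ : Set (EuclideanSpace ℝ (Fin m))) (K : ℝ → ℝ) (b : ℝ)
    (x u : EuclideanSpace ℝ (Fin m)) : ℝ :=
  if (∫ t in D₀, (b ^ m)⁻¹ * K (‖t - u‖ / b)) = 0 then (volume.real D₀)⁻¹
  else ((b ^ m)⁻¹ * K (‖x - u‖ / b)) / ∫ t in D₀, (b ^ m)⁻¹ * K (‖t - u‖ / b)

/-- The proportion of the observations that lie in the estimation domain. -/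
def pHat0 (D : ∀ j, Set (EuclideanSpace ℝ (Fin (L j))))
    (ξ : Fin n → ∀ j, EuclideanSpace ℝ (Fin (L j))) : ℝ :=
  (n : ℝ)⁻¹ * ∑ i, ind D (ξ i)

/-- The mean of the responses over the observations that lie in the estimation domain. -/
def fHat0 (D : ∀ j, Set (EuclideanSpace ℝ (Fin (L j))))
    (ξ : Fin n → ∀ j, EuclideanSpace ℝ (Fin (L j))) (Y : Fin n → H) : H :=
  (pHat0 D ξ * n)⁻¹ • ∑ i, ind D (ξ i) • Y i

/-- The kernel estimator of the joint density on the estimation domain. -/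
def pHat (D : ∀ j, Set (EuclideanSpace ℝ (Fin (L j)))) (K : Fin d → ℝ → ℝ) (h : Fin d → ℝ)
    (ξ : Fin n → ∀ j, EuclideanSpace ℝ (Fin (L j)))
    (x : ∀ j, EuclideanSpace ℝ (Fin (L j))) : ℝ :=
  (pHat0 D ξ * n)⁻¹ *
    ∑ i, (∏ j, kernel (D j) (K j) (h j) (x j) (ξ i j)) * ind D (ξ i)

/-- The kernel estimator of the marginal density of the `j`-th predictor. -/
def pHat1 (D : ∀ j, Set (EuclideanSpace ℝ (Fin (L j)))) (K : Fin d → ℝ → ℝ) (h : Fin d → ℝ)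
    (ξ : Fin n → ∀ j, EuclideanSpace ℝ (Fin (L j)))
    (j : Fin d) (x : EuclideanSpace ℝ (Fin (L j))) : ℝ :=
  (pHat0 D ξ * n)⁻¹ * ∑ i, kernel (D j) (K j) (h j) x (ξ i j) * ind D (ξ i)

/-- The kernel estimator of the joint density of the `j`-th and `k`-th predictors (`j ≠ k`). -/
def pHat2 (D : ∀ j, Set (EuclideanSpace ℝ (Fin (L j)))) (K : Fin d → ℝ → ℝ) (h : Fin d → ℝ)
    (ξ : Fin n → ∀ j, EuclideanSpace ℝ (Fin (L j)))
    (j k : Fin d) (x : EuclideanSpace ℝ (Fin (L j))) (y : EuclideanSpace ℝ (Fin (L k))) : ℝ :=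
  (pHat0 D ξ * n)⁻¹ *
    ∑ i, kernel (D j) (K j) (h j) x (ξ i j) * kernel (D k) (K k) (h k) y (ξ i k) * ind D (ξ i)

/-- The marginal regression estimator for the `j`-th predictor. -/
def mHat (D : ∀ j, Set (EuclideanSpace ℝ (Fin (L j)))) (K : Fin d → ℝ → ℝ) (h : Fin d → ℝ)
    (ξ : Fin n → ∀ j, EuclideanSpace ℝ (Fin (L j))) (Y : Fin n → H)
    (j : Fin d) (x : EuclideanSpace ℝ (Fin (L j))) : H :=
  (pHat1 D K h ξ j x * pHat0 D ξ * n)⁻¹ •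
    ∑ i, (kernel (D j) (K j) (h j) x (ξ i j) * ind D (ξ i)) • Y i

/-- The measure with density `pHat` on the estimation domain. -/
def PHat (D : ∀ j, Set (EuclideanSpace ℝ (Fin (L j)))) (K : Fin d → ℝ → ℝ) (h : Fin d → ℝ)
    (ξ : Fin n → ∀ j, EuclideanSpace ℝ (Fin (L j))) :
    Measure (∀ j, EuclideanSpace ℝ (Fin (L j))) :=
  (volume.restrict (domain D)).withDensity fun x => ENNReal.ofReal (pHat D K h ξ x)

/-- `f` solves the estimated system of Bochner integral equations: all the Bochner integrals
exist, and the equations hold at every point of every `D j`. Only the values of `f j` on `D j`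
matter. -/
structure IsSolution (D : ∀ j, Set (EuclideanSpace ℝ (Fin (L j)))) (K : Fin d → ℝ → ℝ)
    (h : Fin d → ℝ) (ξ : Fin n → ∀ j, EuclideanSpace ℝ (Fin (L j))) (Y : Fin n → H)
    (f : ∀ j, EuclideanSpace ℝ (Fin (L j)) → H) : Prop where
  integrable : ∀ j k, k ≠ j → ∀ x ∈ D j,
    IntegrableOn (fun y => (pHat2 D K h ξ j k x y / pHat1 D K h ξ j x) • f k y) (D k)
  equation : ∀ j, ∀ x ∈ D j,
    f j x = mHat D K h ξ Y j x - fHat0 D ξ Y -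
      ∑ k ∈ Finset.univ.erase j,
        ∫ y in D k, (pHat2 D K h ξ j k x y / pHat1 D K h ξ j x) • f k y

/-- The constraints: each `f j` has (existing) integral zero and finite second moment with
respect to the estimated marginal density. -/
structure SatisfiesConstraints (D : ∀ j, Set (EuclideanSpace ℝ (Fin (L j))))
    (K : Fin d → ℝ → ℝ) (h : Fin d → ℝ) (ξ : Fin n → ∀ j, EuclideanSpace ℝ (Fin (L j)))
    (f : ∀ j, EuclideanSpace ℝ (Fin (L j)) → H) : Prop where
  integrable : ∀ j, IntegrableOn (fun x => pHat1 D K h ξ j x • f j x) (D j)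
  centered : ∀ j, ∫ x in D j, pHat1 D K h ξ j x • f j x = 0
  sq_integrable : ∀ j, IntegrableOn (fun x => ‖f j x‖ ^ 2 * pHat1 D K h ξ j x) (D j)

/-- The data condition: every point of every `D j` is within distance `h j` of the `j`-th
component of an observation that lies in the estimation domain. -/
def ConditionA (D : ∀ j, Set (EuclideanSpace ℝ (Fin (L j)))) (h : Fin d → ℝ)
    (ξ : Fin n → ∀ j, EuclideanSpace ℝ (Fin (L j))) : Prop :=
  ∀ j, ∀ x ∈ D j, ∃ i, ξ i ∈ domain D ∧ ξ i j ∈ Metric.ball x (h j)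

end SBF

end

/-! Only the observations in the domain matter. Their kernel weights `w j i` are probability
densities on `D j`, and the ratio of the estimated densities in (1) is a finite sum of products of
functions of one variable. So `f k` enters the equations only through the vectors `c k i = ∫ w k i •
f k`, and `f j` is the local average of the values `b i - ∑ l ≠ j, c l i`, where `b` denotes the
centered responses. Integrating against `w j i` leaves a finite system `c j = S j (b - ∑ l ≠ j, c
l)` with symmetric matrices `S j` whose rows sum to one (`isSolution_iff`,
`normalEquations_of_isSolution`).

The core is an energy identity for `b = 0`: the sum of all `‖∑ j, c j i‖ ^ 2` and all conditional
variances `∫ w j i * ‖f j - c j i‖ ^ 2` is zero (`NormalEquations.energy_eq_zero`). Hence the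
difference of two solutions has components equal to `c j i` almost everywhere where `w j i ≠ 0`,
with `∑ j, c j i = 0`. This gives (ii), because a positive joint density at a point means that some
observation has nonzero weight in every coordinate. Under the covering condition in (iii) the sum
vanishes on a product of sets of full measure, so each component is constant, and centering makes
the constant zero.

Existence is the Fredholm alternative in finite dimension: the kernel of the transposed system
consists of solutions of the homogeneous equations, and the energy identity makes these orthogonal
to the data. -/

namespace SBF

/-! ### Local averaging with a finite family of densities. -/

section Smoother

variable {ι X E : Type*} [Fintype ι] [MeasurableSpace X]
  [NormedAddCommGroup E] [InnerProductSpace ℝ E]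

/-- A finite family of probability densities with respect to `μ`. -/
structure IsDensityFamily (μ : Measure X) (w : ι → X → ℝ) : Prop where
  nonneg : ∀ i x, 0 ≤ w i x
  integrable : ∀ i, Integrable (w i) μ
  integral_eq_one : ∀ i, ∫ x, w i x ∂μ = 1

/-- The relative weight of the `i`-th density at a point. -/
noncomputable def share (w : ι → X → ℝ) (i : ι) (x : X) : ℝ := w i x / ∑ k, w k x

/-- The local average of the values `g` with the relative weights of the densities. -/
noncomputable def smooth (w : ι → X → ℝ) (g : ι → E) (x : X) : E := ∑ i, share w i x • g i

/-- The matrix of the linear smoother `g ↦ (∫ w i • smooth w g)ᵢ`. -/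
noncomputable def smootherMatrix (μ : Measure X) (w : ι → X → ℝ) (i k : ι) : ℝ :=
  ∫ x, w i x * share w k x ∂μ

variable {μ : Measure X} {w : ι → X → ℝ}

namespace IsDensityFamily

lemma share_nonneg (hw : IsDensityFamily μ w) (i : ι) (x : X) : 0 ≤ share w i x :=
  div_nonneg (hw.nonneg i x) (Finset.sum_nonneg fun k _ => hw.nonneg k x)

lemma share_le_one (hw : IsDensityFamily μ w) (i : ι) (x : X) : share w i x ≤ 1 :=
  div_le_one_of_le₀ (Finset.single_le_sum (fun k _ => hw.nonneg k x) (Finset.mem_univ i))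
    (Finset.sum_nonneg fun k _ => hw.nonneg k x)

/-- Where the total weight is zero, every weight is zero by nonnegativity, so the convention `0 / 0
= 0` is harmless and no positivity assumption is needed. -/
lemma sum_mul_share (hw : IsDensityFamily μ w) (i : ι) (x : X) :
    (∑ k, w k x) * share w i x = w i x := by
  by_cases h : ∑ k, w k x = 0
  · have := (Finset.sum_eq_zero_iff_of_nonneg (fun k _ => hw.nonneg k x)).1 h i (Finset.mem_univ i)
    rw [h, this, zero_mul]
  · rw [share]; field_simp

lemma mul_sum_share (hw : IsDensityFamily μ w) (i : ι) (x : X) :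
    ∑ k, w i x * share w k x = w i x := by
  rw [← Finset.mul_sum]
  by_cases h : ∑ k, w k x = 0
  · have := (Finset.sum_eq_zero_iff_of_nonneg (fun k _ => hw.nonneg k x)).1 h i (Finset.mem_univ i)
    rw [this, zero_mul]
  · simp only [share, ← Finset.sum_div, div_self h, mul_one]

lemma aestronglyMeasurable_share (hw : IsDensityFamily μ w) (i : ι) :
    AEStronglyMeasurable (share w i) μ := by
  unfold share
  have h1 := (hw.integrable i).aemeasurable
  have h2 : AEMeasurable (fun x => ∑ k, w k x) μ :=
    (integrable_finsetSum _ fun k _ => hw.integrable k).aemeasurable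
  exact (h1.div h2).aestronglyMeasurable

lemma norm_share_le (hw : IsDensityFamily μ w) (i : ι) (x : X) : ‖share w i x‖ ≤ 1 := by
  rw [Real.norm_of_nonneg (hw.share_nonneg i x)]; exact hw.share_le_one i x

lemma integrable_mul_share (hw : IsDensityFamily μ w) (i k : ι) :
    Integrable (fun x => w i x * share w k x) μ :=
  (hw.integrable i).mul_bdd (c := 1) (hw.aestronglyMeasurable_share k)
    (Filter.Eventually.of_forall (hw.norm_share_le k))

lemma norm_smooth_le (hw : IsDensityFamily μ w) (g : ι → E) (x : X) :
    ‖smooth w g x‖ ≤ ∑ i, ‖g i‖ := by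
  refine (norm_sum_le _ _).trans (Finset.sum_le_sum fun i _ => ?_)
  rw [norm_smul]
  exact mul_le_of_le_one_left (norm_nonneg _) (hw.norm_share_le i x)

lemma aestronglyMeasurable_smooth (hw : IsDensityFamily μ w) (g : ι → E) :
    AEStronglyMeasurable (smooth w g) μ := by
  unfold smooth
  exact Finset.aestronglyMeasurable_fun_sum _ fun i _ =>
    (hw.aestronglyMeasurable_share i).smul_const (g i)

lemma integrable_smul_smooth (hw : IsDensityFamily μ w) (i : ι) (g : ι → E) :
    Integrable (fun x => w i x • smooth w g x) μ :=
  (hw.integrable i).smul_bdd (∑ i, ‖g i‖) (hw.aestronglyMeasurable_smooth g)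
    (Filter.Eventually.of_forall (hw.norm_smooth_le g))

lemma integrable_mul_norm_smooth_sq (hw : IsDensityFamily μ w) (i : ι) (g : ι → E) :
    Integrable (fun x => w i x * ‖smooth w g x‖ ^ 2) μ := by
  refine (hw.integrable i).mul_bdd (c := (∑ i, ‖g i‖) ^ 2)
    ((hw.aestronglyMeasurable_smooth g).norm.pow 2) (Filter.Eventually.of_forall fun x => ?_)
  rw [Real.norm_of_nonneg (by positivity)]
  gcongr
  exact hw.norm_smooth_le g x

lemma integral_smul_smooth [CompleteSpace E] (hw : IsDensityFamily μ w) (i : ι) (g : ι → E) :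
    ∫ x, w i x • smooth w g x ∂μ = ∑ k, smootherMatrix μ w i k • g k := by
  simp only [smooth, Finset.smul_sum, smul_smul]
  rw [integral_finsetSum _ fun k _ => (hw.integrable_mul_share i k).smul_const (g k)]
  simp only [integral_smul_const, smootherMatrix]

/-- The integrand is `w i * w k / ∑ w`. This symmetry identifies the transposed system with the
normal equations and turns row sums into column sums. -/
lemma smootherMatrix_comm (μ : Measure X) (w : ι → X → ℝ) (i k : ι) :
    smootherMatrix μ w i k = smootherMatrix μ w k i := by
  unfold smootherMatrix share
  congr 1; ext x; ring

lemma sum_smootherMatrix (hw : IsDensityFamily μ w) (i : ι) :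
    ∑ k, smootherMatrix μ w i k = 1 := by
  unfold smootherMatrix
  rw [← integral_finsetSum _ fun k _ => hw.integrable_mul_share i k]
  simp only [hw.mul_sum_share, hw.integral_eq_one]

open scoped InnerProductSpace

lemma sum_smul_smooth (hw : IsDensityFamily μ w) (g : ι → E) (x : X) :
    (∑ i, w i x) • smooth w g x = ∑ i, w i x • g i := by
  simp only [smooth, Finset.smul_sum, smul_smul, hw.sum_mul_share]

lemma mul_norm_sub_sq (w : ℝ) (u c : E) :
    w * ‖u - c‖ ^ 2 = w * ‖u‖ ^ 2 - 2 * ⟪c, w • u⟫_ℝ + w * ‖c‖ ^ 2 := by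
  rw [norm_sub_sq_real, inner_smul_right, real_inner_comm]; ring

lemma integrable_mul_norm_smooth_sub_sq (hw : IsDensityFamily μ w) (g : ι → E) (i : ι) (c : E) :
    Integrable (fun x => w i x * ‖smooth w g x - c‖ ^ 2) μ := by
  simp only [mul_norm_sub_sq]
  exact ((hw.integrable_mul_norm_smooth_sq i g).sub
    (((hw.integrable_smul_smooth i g).const_inner c).const_mul 2)).add
    ((hw.integrable i).mul_const _)

/-- The total conditional variance of the smoothed values. -/
lemma sum_integral_mul_norm_smooth_sub_sq [CompleteSpace E] (hw : IsDensityFamily μ w)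
    (g c : ι → E) (hc : ∀ i, c i = ∑ k, smootherMatrix μ w i k • g k) :
    ∑ i, ∫ x, w i x * ‖smooth w g x - c i‖ ^ 2 ∂μ = ∑ i, ⟪g i, c i⟫_ℝ - ∑ i, ‖c i‖ ^ 2 := by
  have hc' : ∀ i, ∫ x, w i x • smooth w g x ∂μ = c i := fun i => by
    rw [hw.integral_smul_smooth, hc]
  have h1 : ∀ i, ∫ x, w i x * ‖smooth w g x - c i‖ ^ 2 ∂μ
      = (∫ x, w i x * ‖smooth w g x‖ ^ 2 ∂μ) - ‖c i‖ ^ 2 := fun i => by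
    simp only [mul_norm_sub_sq]
    rw [integral_add, integral_sub, integral_const_mul, integral_inner, hc', integral_mul_const,
      hw.integral_eq_one, real_inner_self_eq_norm_sq]
    · ring
    · exact hw.integrable_smul_smooth i g
    · exact hw.integrable_mul_norm_smooth_sq i g
    · exact ((hw.integrable_smul_smooth i g).const_inner _).const_mul 2
    · exact (hw.integrable_mul_norm_smooth_sq i g).sub
        (((hw.integrable_smul_smooth i g).const_inner _).const_mul 2)
    · exact (hw.integrable i).mul_const _
  simp only [h1, Finset.sum_sub_distrib]
  congr 1
  -- The second moments add up to `∑ ⟪g i, c i⟫` pointwise under the integral: `(∑ w i) • smooth w g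
  -- = ∑ w i • g i`, paired with `smooth w g`.
  rw [← integral_finsetSum _ fun i _ => hw.integrable_mul_norm_smooth_sq i g]
  simp only [← hc', ← integral_inner (hw.integrable_smul_smooth _ g)]
  rw [← integral_finsetSum _ fun i _ => (hw.integrable_smul_smooth i g).const_inner (g i)]
  congr 1; ext x
  rw [← Finset.sum_mul, ← real_inner_self_eq_norm_sq, ← real_inner_smul_left,
    hw.sum_smul_smooth, sum_inner]
  simp only [real_inner_smul_left, real_inner_smul_right]

end IsDensityFamily

end Smoother

/-! ### The finite system: energy identity, solvability and centering. -/

section Backfitting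

open scoped InnerProductSpace

variable {J ι E : Type*} [Fintype J] [DecidableEq J] [Fintype ι] {X : J → Type*}
  [∀ j, MeasurableSpace (X j)] [NormedAddCommGroup E] [InnerProductSpace ℝ E]
  {μ : ∀ j, Measure (X j)} {w : ∀ j, ι → X j → ℝ}

/-- The normal equations of additive smoothing, in terms of the integrals `c j i = ∫ w j i • f j`
of the components. -/
def NormalEquations (μ : ∀ j, Measure (X j)) (w : ∀ j, ι → X j → ℝ) (b : ι → E)
    (c : J → ι → E) : Prop :=
  ∀ j i, c j i =
    ∑ k, smootherMatrix (μ j) (w j) i k • (b k - ∑ l ∈ Finset.univ.erase j, c l k)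

/-- The homogeneous normal equations force the total energy to vanish. -/
lemma NormalEquations.energy_eq_zero [CompleteSpace E] (hw : ∀ j, IsDensityFamily (μ j) (w j))
    {c : J → ι → E} (hc : NormalEquations μ w 0 c) :
    (∀ i, ∑ j, c j i = 0) ∧ ∀ j i, ∫ x, w j i x *
      ‖smooth (w j) (fun k => -∑ l ∈ Finset.univ.erase j, c l k) x - c j i‖ ^ 2 ∂(μ j) = 0 := by
  simp only [NormalEquations, Pi.zero_apply, zero_sub] at hc
  have key := fun j => (hw j).sum_integral_mul_norm_smooth_sub_sq _ (c j) (hc j)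
  have h0 : ∀ j i, 0 ≤ ∫ x, w j i x *
      ‖smooth (w j) (fun k => -∑ l ∈ Finset.univ.erase j, c l k) x - c j i‖ ^ 2 ∂(μ j) :=
    fun j i => integral_nonneg fun x => mul_nonneg ((hw j).nonneg i x) (by positivity)
  have h1 : ∀ i, ‖∑ j, c j i‖ ^ 2 =
      ∑ j, ⟪∑ l ∈ Finset.univ.erase j, c l i, c j i⟫_ℝ + ∑ j, ‖c j i‖ ^ 2 := fun i => by
    rw [← real_inner_self_eq_norm_sq, inner_sum, ← Finset.sum_add_distrib]
    refine Finset.sum_congr rfl fun j _ => ?_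
    rw [← Finset.sum_erase_add _ _ (Finset.mem_univ j), inner_add_left, real_inner_self_eq_norm_sq]
  -- The variances of the `j`-th component sum to `-∑ i, ⟪∑ l ≠ j, c l i, c j i⟫ - ∑ i, ‖c j i‖ ^
  -- 2`; summed over `j` this is exactly minus the first term. Two nonnegative quantities with sum
  -- zero both vanish.
  have h2 : (∑ i, ‖∑ j, c j i‖ ^ 2) + ∑ j, ∑ i, ∫ x, w j i x *
      ‖smooth (w j) (fun k => -∑ l ∈ Finset.univ.erase j, c l k) x - c j i‖ ^ 2 ∂(μ j) = 0 := by
    simp only [key, h1, Finset.sum_add_distrib, Finset.sum_sub_distrib, inner_neg_left,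
      Finset.sum_neg_distrib]
    rw [Finset.sum_comm, Finset.sum_comm (s := (Finset.univ : Finset ι))]
    ring
  have h3 : 0 ≤ ∑ i, ‖∑ j, c j i‖ ^ 2 := Finset.sum_nonneg fun _ _ => by positivity
  have h4 := Finset.sum_nonneg fun j (_ : j ∈ Finset.univ) =>
    Finset.sum_nonneg fun i (_ : i ∈ Finset.univ) => h0 j i
  constructor
  · intro i
    have := (Finset.sum_eq_zero_iff_of_nonneg (fun i _ => by positivity)).1
      (le_antisymm (by linarith) h3) i (Finset.mem_univ i)
    simpa using this
  · intro j i
    have := (Finset.sum_eq_zero_iff_of_nonneg (fun j _ => Finset.sum_nonneg fun i _ => h0 j i)).1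
      (le_antisymm (by linarith) h4) j (Finset.mem_univ j)
    exact (Finset.sum_eq_zero_iff_of_nonneg (fun i _ => h0 j i)).1 this i (Finset.mem_univ i)

/-- The unknowns are the values to be smoothed, `g j = b - ∑ l ≠ j, S l (g l)`, rather than the
integrals `c j = S j (g j)`. In this form the transposed homogeneous system is that of the normal
equations, and the right-hand side is the same `b` for every `j`. -/
lemma exists_real_backfit (hw : ∀ j, IsDensityFamily (μ j) (w j)) (b : ι → ℝ) :
    ∃ g : J → ι → ℝ, ∀ j i,
      g j i + ∑ l ∈ Finset.univ.erase j, ∑ k, smootherMatrix (μ l) (w l) i k * g l k = b i := by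
  classical
  let M : (J → ι → ℝ) →ₗ[ℝ] (J → ι → ℝ) :=
    { toFun := fun g j i =>
        g j i + ∑ l ∈ Finset.univ.erase j, ∑ k, smootherMatrix (μ l) (w l) i k * g l k
      map_add' := fun g g' => by
        ext j i; simp only [Pi.add_apply, mul_add, Finset.sum_add_distrib]; ring
      map_smul' := fun r g => by
        ext j i
        simp only [Pi.smul_apply, smul_eq_mul, RingHom.id_apply, mul_add, Finset.mul_sum]
        congr 1
        refine Finset.sum_congr rfl fun l _ => Finset.sum_congr rfl fun k _ => by ring }
  suffices (fun _ => b) ∈ LinearMap.range M by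
    obtain ⟨g, hg⟩ := this
    exact ⟨g, fun j i => congrFun (congrFun hg j) i⟩
  by_contra hb
  -- If the data were not in the range, a functional would vanish on the range but not at the data;
  -- its coordinates `v` will solve the homogeneous normal equations.
  obtain ⟨φ, hφb, hφ⟩ := Submodule.exists_le_ker_of_notMem hb
  let e : J → ι → (J → ι → ℝ) := fun j i => Pi.single j (Pi.single i 1)
  let v : J → ι → ℝ := fun j i => φ (e j i)
  have hφv : ∀ g, φ g = ∑ j, ∑ i, g j i * v j i := fun g => by
    have : g = ∑ j, ∑ i, g j i • e j i := by
      ext j i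
      simp only [e, Finset.sum_apply, Pi.smul_apply, Pi.single_apply, smul_eq_mul]
      rw [Finset.sum_eq_single j (fun l _ hl => ?_) (by simp)]
      · simp [Pi.single_apply]
      · simp [hl.symm]
    conv_lhs => rw [this]
    simp only [map_sum, map_smul, smul_eq_mul, v]
  have hMe : ∀ j i l k, M (e j i) l k =
      (if l = j ∧ k = i then 1 else 0) + if l = j then 0 else smootherMatrix (μ j) (w j) k i := by
    intro j i l k
    simp only [M, e, LinearMap.coe_mk, AddHom.coe_mk]
    congr 1
    · by_cases h : l = j
      · subst h; simp [Pi.single_apply]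
      · simp [h]
    · have : ∀ m, ∑ k', smootherMatrix (μ m) (w m) k k' *
          (Pi.single j (Pi.single i (1 : ℝ)) : J → ι → ℝ) m k' =
          if m = j then smootherMatrix (μ j) (w j) k i else 0 := fun m => by
        by_cases h : m = j
        · subst h; simp [Pi.single_apply]
        · simp [h]
      simp only [this, Finset.sum_ite_eq', Finset.mem_erase, Finset.mem_univ, and_true]
      by_cases h : l = j
      · simp [h]
      · simp [h, Ne.symm h]
  have hv : NormalEquations μ w 0 v := by
    intro j i
    have h0 : φ (M (e j i)) = 0 := hφ ⟨_, rfl⟩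
    rw [hφv] at h0
    simp only [hMe, add_mul, Finset.sum_add_distrib] at h0
    have h1 : ∑ l, ∑ k, (if l = j ∧ k = i then (1 : ℝ) else 0) * v l k = v j i := by
      rw [Finset.sum_eq_single j (fun l _ hl => by simp [hl]) (by simp)]
      simp
    have h2 : ∑ l, ∑ k, (if l = j then 0 else smootherMatrix (μ j) (w j) k i) * v l k =
        ∑ k, smootherMatrix (μ j) (w j) i k * ∑ l ∈ Finset.univ.erase j, v l k := by
      rw [Finset.sum_comm]
      refine Finset.sum_congr rfl fun k _ => ?_
      rw [Finset.mul_sum, ← Finset.add_sum_erase _ _ (Finset.mem_univ j), if_pos rfl, zero_mul,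
        zero_add]
      refine Finset.sum_congr rfl fun l hl => ?_
      rw [if_neg (Finset.ne_of_mem_erase hl), IsDensityFamily.smootherMatrix_comm]
    rw [h1, h2] at h0
    simp only [Pi.zero_apply, zero_sub, smul_eq_mul, mul_neg, Finset.sum_neg_distrib]
    linarith
  -- The functional takes the value `∑ i, b i * ∑ j, v j i` at the data, and the energy identity
  -- makes each inner sum zero.
  apply hφb
  rw [hφv, Finset.sum_comm]
  simp only [← Finset.mul_sum, (NormalEquations.energy_eq_zero hw hv).1, mul_zero,
    Finset.sum_const_zero]

/-- The coefficients are real, so it suffices to solve for each unit vector of `ι → ℝ` and combine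
the solutions with the vectors `b m` as coefficients; the dimension of `E` plays no role. -/
lemma exists_normalEquations (hw : ∀ j, IsDensityFamily (μ j) (w j)) (b : ι → E) :
    ∃ c : J → ι → E, NormalEquations μ w b c := by
  classical
  choose g hg using fun i => exists_real_backfit hw (Pi.single i (1 : ℝ))
  let G : J → ι → E := fun j i => ∑ m, g m j i • b m
  let c : J → ι → E := fun j i => ∑ k, smootherMatrix (μ j) (w j) i k • G j k
  have hG : ∀ j i, G j i = b i - ∑ l ∈ Finset.univ.erase j, c l i := fun j i => by
    have h1 : ∀ l, c l i = ∑ m, (∑ k, smootherMatrix (μ l) (w l) i k * g m l k) • b m := fun l => by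
      simp only [c, G, Finset.smul_sum, Finset.sum_smul, smul_smul]
      exact Finset.sum_comm
    have h2 : b i = ∑ m, (Pi.single m (1 : ℝ) : ι → ℝ) i • b m := by
      simp [Pi.single_apply]
    rw [h2, eq_sub_iff_add_eq, Finset.sum_congr rfl fun l _ => h1 l, Finset.sum_comm]
    simp only [G, ← Finset.sum_smul, ← Finset.sum_add_distrib, ← add_smul, hg]
  exact ⟨c, fun j i => by simp only [← hG]; rfl⟩

/-- For centered data, the normal equations have a solution with centered components. -/
lemma exists_centered_normalEquations [Nonempty ι] (hw : ∀ j, IsDensityFamily (μ j) (w j))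
    (b : ι → E) (hb : ∑ i, b i = 0) :
    ∃ c : J → ι → E, NormalEquations μ w b c ∧ ∀ j, ∑ i, c j i = 0 := by
  obtain ⟨c, hc⟩ := exists_normalEquations hw b
  let N : ℝ := Fintype.card ι
  have hN : N ≠ 0 := by simp [N]
  let m : J → E := fun j => N⁻¹ • ∑ i, c j i
  have hsum : ∀ j : J, ∑ k, m k = 0 := fun j => by
    -- The columns of `S j` sum to one, so adding up the `j`-th equation over all observations
    -- removes the matrix.
    have h1 : ∑ i, c j i = ∑ k, (b k - ∑ l ∈ Finset.univ.erase j, c l k) := by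
      rw [Finset.sum_congr rfl fun i _ => hc j i, Finset.sum_comm]
      refine Finset.sum_congr rfl fun k _ => ?_
      rw [← Finset.sum_smul]
      simp only [IsDensityFamily.smootherMatrix_comm (μ j) (w j) _ k, (hw j).sum_smootherMatrix,
        one_smul]
    rw [Finset.sum_sub_distrib, hb, zero_sub, eq_neg_iff_add_eq_zero, ← Finset.sum_add_distrib]
      at h1
    rw [Finset.sum_congr rfl fun i _ => Finset.add_sum_erase _ (fun l => c l i) (Finset.mem_univ j)]
      at h1
    rw [← Finset.smul_sum, Finset.sum_comm, h1, smul_zero]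
  -- Since the means add up to zero, subtracting them shifts the smoothed values of the `j`-th
  -- equation by `-m j`, and `S j` preserves constants.
  refine ⟨fun j i => c j i - m j, fun j i => ?_, fun j => ?_⟩
  · simp only
    have h2 : ∀ k, b k - ∑ l ∈ Finset.univ.erase j, (c l k - m l) =
        (b k - ∑ l ∈ Finset.univ.erase j, c l k) - m j := fun k => by
      have := hsum j
      rw [← Finset.add_sum_erase _ _ (Finset.mem_univ j), add_eq_zero_iff_eq_neg] at this
      rw [Finset.sum_sub_distrib, this]; abel
    rw [Finset.sum_congr rfl fun k _ => congrArg _ (h2 k)]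
    simp only [smul_sub _ _ (m j), Finset.sum_sub_distrib _ (fun _ => _ • m j), ← Finset.sum_smul,
      (hw j).sum_smootherMatrix, one_smul]
    rw [← hc j i]
  · rw [Finset.sum_sub_distrib, Finset.sum_const, ← Nat.cast_smul_eq_nsmul ℝ, smul_smul]
    simp only [Finset.card_univ]
    rw [mul_inv_cancel₀ hN, one_smul, sub_self]

end Backfitting

/-! ### Differences of solutions, and separation of variables. -/

section Linear

variable {ι E : Type*} [Fintype ι] [NormedAddCommGroup E] [InnerProductSpace ℝ E]

lemma smooth_sub {X : Type*} (w : ι → X → ℝ) (g g' : ι → E) (x : X) :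
    smooth w (g - g') x = smooth w g x - smooth w g' x := by
  simp only [smooth, Pi.sub_apply, smul_sub, Finset.sum_sub_distrib]

lemma NormalEquations.sub {J : Type*} [Fintype J] [DecidableEq J] {X : J → Type*}
    [∀ j, MeasurableSpace (X j)] {μ : ∀ j, Measure (X j)} {w : ∀ j, ι → X j → ℝ} {b b' : ι → E}
    {c c' : J → ι → E} (hc : NormalEquations μ w b c) (hc' : NormalEquations μ w b' c') :
    NormalEquations μ w (b - b') (c - c') := fun j i => by
  simp only [Pi.sub_apply]
  rw [hc j i, hc' j i, ← Finset.sum_sub_distrib]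
  refine Finset.sum_congr rfl fun k _ => ?_
  rw [← smul_sub, Finset.sum_sub_distrib]
  congr 1; abel

/-- If a sum of functions of separate variables vanishes on a product, each of them is constant. -/
lemma eq_of_sum_eq_zero_on_pi {J E : Type*} [Fintype J] [DecidableEq J] [AddCommGroup E]
    {X : J → Type*} {F : ∀ j, X j → E} {S : ∀ j, Set (X j)}
    (hF : ∀ x ∈ Set.univ.pi S, ∑ j, F j (x j) = 0) {z : ∀ j, X j} (hz : z ∈ Set.univ.pi S)
    {j : J} {x : X j} (hx : x ∈ S j) : F j x = F j (z j) := by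
  have h1 := hF z hz
  have h2 := hF (Function.update z j x)
    (Set.update_mem_pi_iff_of_mem hz |>.2 fun _ => hx)
  rw [← Finset.add_sum_erase _ _ (Finset.mem_univ j)] at h1 h2
  rw [Finset.sum_congr rfl fun k hk => by
    rw [Function.update_of_ne (Finset.ne_of_mem_erase hk)], Function.update_self] at h2
  exact add_right_cancel (h2.trans h1.symm)

end Linear

/-! ### The normalized kernel as a probability density. -/

section Kernel

variable {m : ℕ} {D₀ : Set (EuclideanSpace ℝ (Fin m))} {K : ℝ → ℝ} {b : ℝ}

lemma continuous_profile (hK : ContinuousOn K (Set.Ici 0)) (hb : 0 < b)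
    (u : EuclideanSpace ℝ (Fin m)) : Continuous fun x => (b ^ m)⁻¹ * K (‖x - u‖ / b) := by
  refine continuous_const.mul (hK.comp_continuous (by fun_prop) fun x => ?_)
  exact div_nonneg (norm_nonneg _) hb.le

lemma continuous_kernel (hK : ContinuousOn K (Set.Ici 0)) (hb : 0 < b)
    (u : EuclideanSpace ℝ (Fin m)) : Continuous fun x => kernel D₀ K b x u := by
  unfold kernel
  split_ifs
  · exact continuous_const
  · exact (continuous_profile hK hb u).div_const _

lemma kernel_nonneg (hK : ∀ t, 0 ≤ t → 0 ≤ K t) (hb : 0 < b) (x u : EuclideanSpace ℝ (Fin m)) :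
    0 ≤ kernel D₀ K b x u := by
  have h : ∀ t : EuclideanSpace ℝ (Fin m), 0 ≤ (b ^ m)⁻¹ * K (‖t - u‖ / b) := fun t =>
    mul_nonneg (by positivity) (hK _ (by positivity))
  unfold kernel
  split_ifs
  · positivity
  · exact div_nonneg (h x) (integral_nonneg h)

lemma kernel_pos (hK : ∀ t, 0 ≤ t → 0 ≤ K t) (hK1 : ∀ t ∈ Set.Ico (0 : ℝ) 1, 0 < K t)
    (hb : 0 < b) (hD : 0 < volume.real D₀) {x u : EuclideanSpace ℝ (Fin m)} (hxu : ‖x - u‖ < b) :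
    0 < kernel D₀ K b x u := by
  have h : ∀ t : EuclideanSpace ℝ (Fin m), 0 ≤ (b ^ m)⁻¹ * K (‖t - u‖ / b) := fun t =>
    mul_nonneg (by positivity) (hK _ (by positivity))
  unfold kernel
  split_ifs with h0
  · positivity
  · refine div_pos (mul_pos (by positivity) (hK1 _ ⟨by positivity, (div_lt_one hb).2 hxu⟩)) ?_
    exact lt_of_le_of_ne (integral_nonneg h) (Ne.symm h0)

/-- The default value, the uniform density, keeps the total mass equal to one also when the
normalizing integral vanishes. -/
lemma integral_kernel (hD : volume.real D₀ ≠ 0) (u : EuclideanSpace ℝ (Fin m)) :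
    ∫ x in D₀, kernel D₀ K b x u = 1 := by
  by_cases h : (∫ t in D₀, (b ^ m)⁻¹ * K (‖t - u‖ / b)) = 0
  · simp only [kernel, h, if_true]
    rw [setIntegral_const, smul_eq_mul, mul_inv_cancel₀ hD]
  · simp only [kernel, h, if_false]
    rw [integral_div, div_self h]

end Kernel

/-! ### The estimators in terms of the kernel weights of the observations in the domain. -/

section Model

variable {d n : ℕ} {L : Fin d → ℕ}
  {H : Type*} [NormedAddCommGroup H] [InnerProductSpace ℝ H]
  (D : ∀ j, Set (EuclideanSpace ℝ (Fin (L j)))) (K : Fin d → ℝ → ℝ) (h : Fin d → ℝ)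
  (ξ : Fin n → ∀ j, EuclideanSpace ℝ (Fin (L j)))

/-- The indices of the observations in the estimation domain. -/
abbrev Obs : Type := {i : Fin n // ξ i ∈ domain D}

noncomputable instance : Fintype (Obs D ξ) :=
  Fintype.ofFinite _

/-- The kernel weight of an observation in the estimation domain. -/
noncomputable def weight (j : Fin d) (i : Obs D ξ) (x : EuclideanSpace ℝ (Fin (L j))) : ℝ :=
  kernel (D j) (K j) (h j) x (ξ i.1 j)

/-- The standing assumptions on the domain, the kernels, the bandwidths and the data. -/
structure Admissible : Prop where
  isCompact : ∀ j, IsCompact (D j)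
  volume_pos : ∀ j, 0 < volume (D j)
  continuousOn : ∀ j, ContinuousOn (K j) (Set.Ici 0)
  pos : ∀ j, ∀ t ∈ Set.Ico (0 : ℝ) 1, 0 < K j t
  eq_zero : ∀ j, ∀ t ∈ Set.Ici (1 : ℝ), K j t = 0
  bandwidth_pos : ∀ j, 0 < h j
  nonempty : Nonempty (Obs D ξ)
  conditionA : ConditionA D h ξ

variable {D K h ξ}

lemma ind_of_mem {z : ∀ j, EuclideanSpace ℝ (Fin (L j))} (hz : z ∈ domain D) : ind D z = 1 :=
  Set.indicator_of_mem hz _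

lemma ind_of_notMem {z : ∀ j, EuclideanSpace ℝ (Fin (L j))} (hz : z ∉ domain D) : ind D z = 0 :=
  Set.indicator_of_notMem hz _

lemma sum_eq_sum_obs {M : Type*} [AddCommMonoid M] (F : Fin n → M) (F' : Obs D ξ → M)
    (h0 : ∀ i, ξ i ∉ domain D → F i = 0) (h1 : ∀ i : Obs D ξ, F i.1 = F' i) :
    ∑ i, F i = ∑ i, F' i := by
  classical
  rw [← Finset.sum_congr rfl fun i _ => h1 i,
    ← Finset.sum_filter_of_ne (p := fun i => ξ i ∈ domain D) fun i _ hi => by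
      by_contra hn; exact hi (h0 i hn)]
  exact Finset.sum_subtype _ (by simp) F

lemma sum_mul_ind (F : Fin n → ℝ) :
    ∑ i, F i * ind D (ξ i) = ∑ i : Obs D ξ, F i.1 :=
  sum_eq_sum_obs _ _ (fun i hi => by rw [ind_of_notMem hi, mul_zero])
    fun i => by rw [ind_of_mem i.2, mul_one]

lemma obs_mem (i : Obs D ξ) (j : Fin d) : ξ i.1 j ∈ D j := i.2 j (Set.mem_univ j)

namespace Admissible

variable (hR : Admissible D K h ξ)
include hR

lemma nonneg (j : Fin d) (t : ℝ) (ht : 0 ≤ t) : 0 ≤ K j t := by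
  rcases lt_or_ge t 1 with h1 | h1
  · exact (hR.pos j t ⟨ht, h1⟩).le
  · exact (hR.eq_zero j t h1).ge

lemma volume_real_pos (j : Fin d) : 0 < volume.real (D j) :=
  ENNReal.toReal_pos (hR.volume_pos j).ne' (hR.isCompact j).measure_lt_top.ne

lemma measurableSet (j : Fin d) : MeasurableSet (D j) := (hR.isCompact j).measurableSet

lemma continuous_weight (j : Fin d) (i : Obs D ξ) : Continuous (weight D K h ξ j i) :=
  continuous_kernel (hR.continuousOn j) (hR.bandwidth_pos j) _

lemma isDensityFamily (j : Fin d) :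
    IsDensityFamily (volume.restrict (D j)) (weight D K h ξ j) where
  nonneg _ _ := kernel_nonneg (hR.nonneg j) (hR.bandwidth_pos j) _ _
  integrable i := (hR.continuous_weight j i).continuousOn.integrableOn_compact (hR.isCompact j)
  integral_eq_one _ := integral_kernel (hR.volume_real_pos j).ne' _

lemma weight_pos {j : Fin d} {i : Obs D ξ} {x : EuclideanSpace ℝ (Fin (L j))}
    (hx : ξ i.1 j ∈ Metric.ball x (h j)) : 0 < weight D K h ξ j i x :=
  kernel_pos (hR.nonneg j) (hR.pos j) (hR.bandwidth_pos j) (hR.volume_real_pos j)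
    (by rwa [Metric.mem_ball, dist_comm, dist_eq_norm] at hx)

lemma card_pos : (0 : ℝ) < Fintype.card (Obs D ξ) := by
  have := hR.nonempty
  exact_mod_cast Fintype.card_pos

lemma pHat0_mul : pHat0 D ξ * n = Fintype.card (Obs D ξ) := by
  have hn : (n : ℝ) ≠ 0 := by
    obtain ⟨i⟩ := hR.nonempty
    exact_mod_cast (Fin.pos i.1).ne'
  have := sum_mul_ind (D := D) (ξ := ξ) fun _ => 1
  simp only [one_mul, Finset.sum_const, Finset.card_univ, nsmul_eq_mul, mul_one] at this
  rw [pHat0, this]; field_simp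

lemma fHat0_eq (Y : Fin n → H) :
    fHat0 D ξ Y = (Fintype.card (Obs D ξ) : ℝ)⁻¹ • ∑ i : Obs D ξ, Y i.1 := by
  rw [fHat0, hR.pHat0_mul, sum_eq_sum_obs (D := D) (ξ := ξ) _ (fun i => Y i.1)]
  · intro i hi; rw [ind_of_notMem hi, zero_smul]
  · intro i; rw [ind_of_mem i.2, one_smul]

lemma pHat_eq (x : ∀ j, EuclideanSpace ℝ (Fin (L j))) :
    pHat D K h ξ x = (Fintype.card (Obs D ξ) : ℝ)⁻¹ * ∑ i, ∏ j, weight D K h ξ j i (x j) := by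
  rw [pHat, hR.pHat0_mul, sum_mul_ind]; rfl

lemma pHat1_eq (j : Fin d) (x : EuclideanSpace ℝ (Fin (L j))) :
    pHat1 D K h ξ j x = (Fintype.card (Obs D ξ) : ℝ)⁻¹ * ∑ i, weight D K h ξ j i x := by
  rw [pHat1, hR.pHat0_mul, sum_mul_ind]; rfl

lemma pHat2_eq (j k : Fin d) (x : EuclideanSpace ℝ (Fin (L j)))
    (y : EuclideanSpace ℝ (Fin (L k))) :
    pHat2 D K h ξ j k x y = (Fintype.card (Obs D ξ) : ℝ)⁻¹ *
      ∑ i, weight D K h ξ j i x * weight D K h ξ k i y := by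
  rw [pHat2, hR.pHat0_mul, sum_mul_ind]; rfl

lemma mHat_eq (Y : Fin n → H) (j : Fin d) (x : EuclideanSpace ℝ (Fin (L j))) :
    mHat D K h ξ Y j x = smooth (weight D K h ξ j) (fun i => Y i.1) x := by
  rw [mHat, mul_assoc, hR.pHat0_mul, hR.pHat1_eq, mul_right_comm,
    inv_mul_cancel₀ hR.card_pos.ne', one_mul,
    sum_eq_sum_obs (D := D) (ξ := ξ) _ (fun i => weight D K h ξ j i x • Y i.1), Finset.smul_sum]
  · simp only [smooth, share, smul_smul, div_eq_inv_mul]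
  · intro i hi; rw [ind_of_notMem hi, mul_zero, zero_smul]
  · intro i; rw [ind_of_mem i.2, mul_one]; rfl

/-- This separation of variables makes the integral operators finite-rank. -/
lemma pHat2_div_pHat1 (j k : Fin d) (x : EuclideanSpace ℝ (Fin (L j)))
    (y : EuclideanSpace ℝ (Fin (L k))) :
    pHat2 D K h ξ j k x y / pHat1 D K h ξ j x =
      ∑ i, share (weight D K h ξ j) i x * weight D K h ξ k i y := by
  rw [hR.pHat1_eq, hR.pHat2_eq, mul_div_mul_left _ _ (inv_ne_zero hR.card_pos.ne'), Finset.sum_div]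
  exact Finset.sum_congr rfl fun i _ => by rw [share]; ring

lemma sum_weight_pos {j : Fin d} {x : EuclideanSpace ℝ (Fin (L j))} (hx : x ∈ D j) :
    0 < ∑ i, weight D K h ξ j i x := by
  obtain ⟨i, hi, hix⟩ := hR.conditionA j x hx
  exact (hR.weight_pos (i := ⟨i, hi⟩) hix).trans_le
    (Finset.single_le_sum (fun k _ => (hR.isDensityFamily j).nonneg k x) (Finset.mem_univ _))

/-- Condition (A) enters here: constants such as `fHat0` may be moved inside the local average at
every point of `D j`. -/
lemma sum_share {j : Fin d} {x : EuclideanSpace ℝ (Fin (L j))} (hx : x ∈ D j) :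
    ∑ i, share (weight D K h ξ j) i x = 1 := by
  simp only [share, ← Finset.sum_div, div_self (hR.sum_weight_pos hx).ne']

lemma share_pos (j : Fin d) (i : Obs D ξ) : 0 < share (weight D K h ξ j) i (ξ i.1 j) :=
  div_pos (hR.weight_pos (Metric.mem_ball_self (hR.bandwidth_pos j)))
    (hR.sum_weight_pos (obs_mem i j))

/-! ### Reduction of the integral equations to the finite system. -/

lemma integral_ratio_smul {f : ∀ j, EuclideanSpace ℝ (Fin (L j)) → H} {k : Fin d}
    (hf : ∀ i, IntegrableOn (fun y => weight D K h ξ k i y • f k y) (D k)) (j : Fin d)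
    (x : EuclideanSpace ℝ (Fin (L j))) :
    IntegrableOn (fun y => (pHat2 D K h ξ j k x y / pHat1 D K h ξ j x) • f k y) (D k) ∧
    ∫ y in D k, (pHat2 D K h ξ j k x y / pHat1 D K h ξ j x) • f k y =
      ∑ i, share (weight D K h ξ j) i x • ∫ y in D k, weight D K h ξ k i y • f k y := by
  simp only [hR.pHat2_div_pHat1, Finset.sum_smul, mul_smul]
  have h1 : ∀ i, IntegrableOn (fun y =>
      share (weight D K h ξ j) i x • weight D K h ξ k i y • f k y) (D k) := fun i => (hf i).smul _
  constructor
  · exact integrable_finsetSum _ fun i _ => h1 i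
  · rw [integral_finsetSum _ fun i _ => h1 i]
    simp only [integral_smul]

/-- At the point `x = ξ i j` the `i`-th share is positive, so the ratio of densities dominates a
positive multiple of the single weight `w k i`. Integrability against the ratio therefore passes to
each weight. -/
lemma integrableOn_weight_smul {f : ∀ j, EuclideanSpace ℝ (Fin (L j)) → H} {j k : Fin d}
    (hf : ∀ x ∈ D j,
      IntegrableOn (fun y => (pHat2 D K h ξ j k x y / pHat1 D K h ξ j x) • f k y) (D k))
    (i : Obs D ξ) : IntegrableOn (fun y => weight D K h ξ k i y • f k y) (D k) := by
  have h1 := hf _ (obs_mem i j)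
  simp only [hR.pHat2_div_pHat1] at h1
  set a := fun i' => share (weight D K h ξ j) i' (ξ i.1 j) with ha
  have ha0 : ∀ i', 0 ≤ a i' := fun i' => (hR.isDensityFamily j).share_nonneg i' _
  have hai : 0 < a i := hR.share_pos j i
  have hw := (hR.isDensityFamily k).nonneg
  have hle : ∀ y, a i * weight D K h ξ k i y ≤ ∑ i', a i' * weight D K h ξ k i' y := fun y =>
    Finset.single_le_sum (f := fun i' => a i' * weight D K h ξ k i' y)
      (fun i' _ => mul_nonneg (ha0 i') (hw i' y)) (Finset.mem_univ i)
  have hS : ∀ y, 0 ≤ ∑ i', a i' * weight D K h ξ k i' y := fun y =>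
    Finset.sum_nonneg fun i' _ => mul_nonneg (ha0 i') (hw i' y)
  have hmeas : Measurable fun y => weight D K h ξ k i y / ∑ i', a i' * weight D K h ξ k i' y :=
    (hR.continuous_weight k i).measurable.div
      (Finset.measurable_fun_sum _ fun i' _ => (hR.continuous_weight k i').measurable.const_mul _)
  have h2 := Integrable.bdd_smul h1 (a i)⁻¹ hmeas.aestronglyMeasurable
    (Filter.Eventually.of_forall fun y => by
      rw [Real.norm_of_nonneg (div_nonneg (hw i y) (hS y))]
      rcases (hS y).eq_or_lt with h0 | h0
      · rw [← h0, div_zero]; positivity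
      · rw [div_le_iff₀ h0, inv_mul_eq_div, le_div_iff₀ hai, mul_comm]; exact hle y)
  refine h2.congr (Filter.Eventually.of_forall fun y => ?_)
  simp only [Pi.smul_apply', smul_smul]
  congr 1
  -- Where the dominating sum is zero the quotient is `0` by convention, but there the weight itself
  -- is zero.
  rcases (hS y).eq_or_lt with h0 | h0
  · have := hle y
    rw [← h0] at this
    have hz : weight D K h ξ k i y = 0 := le_antisymm (by
      by_contra hn; exact absurd this (not_le.2 (mul_pos hai (not_le.1 hn)))) (hw i y)
    rw [hz]; simp
  · exact div_mul_cancel₀ _ h0.ne'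

/-- The integral equations as fixed-point equations for local averages. -/
lemma isSolution_iff (Y : Fin n → H) (f : ∀ j, EuclideanSpace ℝ (Fin (L j)) → H) :
    IsSolution D K h ξ Y f ↔
      (∀ j k, k ≠ j → ∀ i, IntegrableOn (fun y => weight D K h ξ k i y • f k y) (D k)) ∧
      ∀ j, ∀ x ∈ D j, f j x = smooth (weight D K h ξ j) (fun i => (Y i.1 - fHat0 D ξ Y) -
        ∑ k ∈ Finset.univ.erase j, ∫ y in D k, weight D K h ξ k i y • f k y) x := by
  have key : (∀ j k, k ≠ j → ∀ i, IntegrableOn (fun y => weight D K h ξ k i y • f k y) (D k)) →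
      ∀ j, ∀ x ∈ D j, mHat D K h ξ Y j x - fHat0 D ξ Y - ∑ k ∈ Finset.univ.erase j,
        ∫ y in D k, (pHat2 D K h ξ j k x y / pHat1 D K h ξ j x) • f k y =
      smooth (weight D K h ξ j) (fun i => (Y i.1 - fHat0 D ξ Y) -
        ∑ k ∈ Finset.univ.erase j, ∫ y in D k, weight D K h ξ k i y • f k y) x := by
    intro hf j x hx
    rw [Finset.sum_congr rfl fun k hk =>
      (hR.integral_ratio_smul (hf j k (Finset.ne_of_mem_erase hk)) j x).2, hR.mHat_eq]
    simp only [smooth, smul_sub, Finset.sum_sub_distrib, ← Finset.sum_smul, hR.sum_share hx,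
      one_smul, Finset.smul_sum]
    rw [Finset.sum_comm]
  constructor
  · intro hs
    have hf : ∀ j k, k ≠ j → ∀ i,
        IntegrableOn (fun y => weight D K h ξ k i y • f k y) (D k) := fun j k hkj =>
      hR.integrableOn_weight_smul (hs.integrable j k hkj)
    exact ⟨hf, fun j x hx => by rw [hs.equation j x hx, key hf j x hx]⟩
  · rintro ⟨hf, he⟩
    exact ⟨fun j k hkj x _ => (hR.integral_ratio_smul (hf j k hkj) j x).1,
      fun j x hx => by rw [he j x hx, key hf j x hx]⟩

lemma exists_solution [CompleteSpace H] (Y : Fin n → H) :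
    ∃ f : ∀ j, EuclideanSpace ℝ (Fin (L j)) → H,
      IsSolution D K h ξ Y f ∧ SatisfiesConstraints D K h ξ f := by
  have := hR.nonempty
  have hw := hR.isDensityFamily
  obtain ⟨c, hc, hc0⟩ := exists_centered_normalEquations hw
    -- `fHat0` is the mean of the responses in the domain, so these data sum to zero, as the
    -- centered solution requires.
    (fun i : Obs D ξ => Y i.1 - fHat0 D ξ Y) (by
      rw [Finset.sum_sub_distrib, hR.fHat0_eq, Finset.sum_const, ← Nat.cast_smul_eq_nsmul ℝ,
        smul_smul, Finset.card_univ, mul_inv_cancel₀ hR.card_pos.ne', one_smul, sub_self])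
  let f : ∀ j, EuclideanSpace ℝ (Fin (L j)) → H := fun j =>
    smooth (weight D K h ξ j) fun i =>
      (Y i.1 - fHat0 D ξ Y) - ∑ l ∈ Finset.univ.erase j, c l i
  have hint : ∀ j i, IntegrableOn (fun y => weight D K h ξ j i y • f j y) (D j) := fun j i =>
    (hw j).integrable_smul_smooth i _
  have hfc : ∀ j i, ∫ y in D j, weight D K h ξ j i y • f j y = c j i := fun j i => by
    rw [hc j i, ← (hw j).integral_smul_smooth]
  have hsum : ∀ j x, pHat1 D K h ξ j x • f j x =
      (Fintype.card (Obs D ξ) : ℝ)⁻¹ • ∑ i, weight D K h ξ j i x • f j x := fun j x => by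
    rw [hR.pHat1_eq, mul_smul, Finset.sum_smul]
  refine ⟨f, (hR.isSolution_iff Y f).2 ⟨fun _ k _ => hint k, fun j x _ => ?_⟩, ?_, ?_, ?_⟩
  · simp only [hfc]; rfl
  · intro j
    simp only [hsum]
    exact (integrable_finsetSum _ fun i _ => hint j i).smul _
  · intro j
    simp only [hsum]
    rw [integral_smul, integral_finsetSum _ fun i _ => hint j i]
    simp only [hfc, hc0, smul_zero]
  · intro j
    have : ∀ x, ‖f j x‖ ^ 2 * pHat1 D K h ξ j x =
        (Fintype.card (Obs D ξ) : ℝ)⁻¹ * ∑ i, weight D K h ξ j i x * ‖f j x‖ ^ 2 := fun x => by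
      rw [hR.pHat1_eq, ← Finset.sum_mul]; ring
    simp only [this]
    exact (integrable_finsetSum _ fun i _ =>
      (hw j).integrable_mul_norm_smooth_sq i _).const_mul _

/-- On `D j` a solution coincides with a local average, whose weighted integrals are given by the
smoother matrix. This also covers `d = 1`, where being a solution asserts no integrability. -/
lemma normalEquations_of_isSolution [CompleteSpace H] {Y : Fin n → H}
    {f : ∀ j, EuclideanSpace ℝ (Fin (L j)) → H} (hf : IsSolution D K h ξ Y f) :
    NormalEquations (fun j => volume.restrict (D j)) (weight D K h ξ)
      (fun i => Y i.1 - fHat0 D ξ Y)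
      (fun j i => ∫ y in D j, weight D K h ξ j i y • f j y) := by
  intro j i
  simp only
  rw [← (hR.isDensityFamily j).integral_smul_smooth]
  exact setIntegral_congr_fun (hR.measurableSet j) fun x hx => by
    rw [((hR.isSolution_iff Y f).1 hf).2 j x hx]

/-- The components of the difference of two solutions are constant on the support of every
observation's kernel, and for every observation these constants add up to zero. -/
lemma exists_sub_eq_const [CompleteSpace H] {Y : Fin n → H}
    {f g : ∀ j, EuclideanSpace ℝ (Fin (L j)) → H}
    (hf : IsSolution D K h ξ Y f) (hg : IsSolution D K h ξ Y g) :
    ∃ c : Fin d → Obs D ξ → H, (∀ i, ∑ j, c j i = 0) ∧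
      ∀ j, ∀ᵐ x ∂(volume.restrict (D j)), ∀ i, weight D K h ξ j i x ≠ 0 →
        f j x - g j x = c j i := by
  have hN := (hR.normalEquations_of_isSolution hf).sub (hR.normalEquations_of_isSolution hg)
  rw [sub_self] at hN
  obtain ⟨h0, hE⟩ := NormalEquations.energy_eq_zero hR.isDensityFamily hN
  refine ⟨_, h0, fun j => ?_⟩
  rw [ae_all_iff]
  intro i
  have hw := hR.isDensityFamily j
  have h1 := (integral_eq_zero_iff_of_nonneg
    (fun x => mul_nonneg (hw.nonneg i x) (by positivity))
    (hw.integrable_mul_norm_smooth_sub_sq _ i _)).1 (hE j i)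
  filter_upwards [h1, ae_restrict_mem (hR.measurableSet j)] with x hx hxD hwx
  simp only [Pi.zero_apply, mul_eq_zero, hwx, false_or, ne_eq, OfNat.ofNat_ne_zero,
    not_false_eq_true, pow_eq_zero_iff, norm_eq_zero, sub_eq_zero] at hx
  -- The difference of two local averages is the local average of the differences, in which the
  -- responses cancel.
  rw [← hx, ((hR.isSolution_iff Y f).1 hf).2 j x hxD, ((hR.isSolution_iff Y g).1 hg).2 j x hxD,
    ← smooth_sub]
  congr 1
  ext k
  simp only [Pi.sub_apply, Finset.sum_sub_distrib]
  abel

/-! ### Uniqueness of the sum and of the components. -/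

lemma measurable_pHat : Measurable (pHat D K h ξ) := by
  simp only [funext hR.pHat_eq]
  exact (Finset.measurable_fun_sum _ fun i _ => Finset.measurable_fun_prod _ fun j _ =>
    (hR.continuous_weight j i).measurable.comp (measurable_pi_apply j)).const_mul _

lemma ae_sum_eq [CompleteSpace H] {Y : Fin n → H}
    {f g : ∀ j, EuclideanSpace ℝ (Fin (L j)) → H}
    (hf : IsSolution D K h ξ Y f) (hg : IsSolution D K h ξ Y g) :
    ∀ᵐ x ∂(PHat D K h ξ), ∑ j, f j (x j) = ∑ j, g j (x j) := by
  obtain ⟨c, h0, hc⟩ := hR.exists_sub_eq_const hf hg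
  rw [PHat, ae_withDensity_iff hR.measurable_pHat.ennreal_ofReal, domain, volume_pi,
    Measure.restrict_pi_pi]
  have hc' : ∀ᵐ x ∂(Measure.pi fun j => volume.restrict (D j)), ∀ j i,
      weight D K h ξ j i (x j) ≠ 0 → f j (x j) - g j (x j) = c j i :=
    ae_all_iff.2 fun j => 
      (Measure.quasiMeasurePreserving_eval (fun j => volume.restrict (D j)) j).ae (hc j)
  filter_upwards [hc'] with x hx hp
  have hp' : pHat D K h ξ x ≠ 0 := fun hz => hp (by rw [hz, ENNReal.ofReal_zero])
  rw [hR.pHat_eq] at hp'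
  -- One observation `i` has nonzero weight in all coordinates at once, so every component
  -- difference equals its own `c j i`, and these sum to zero.
  obtain ⟨i, -, hi⟩ := Finset.exists_ne_zero_of_sum_ne_zero (right_ne_zero_of_mul hp')
  rw [← sub_eq_zero, ← Finset.sum_sub_distrib, ← h0 i]
  exact Finset.sum_congr rfl fun j _ => hx j i (Finset.prod_ne_zero_iff.1 hi j (Finset.mem_univ j))

lemma integral_pHat1 (j : Fin d) : ∫ x in D j, pHat1 D K h ξ j x = 1 := by
  simp only [hR.pHat1_eq]
  rw [integral_const_mul, integral_finsetSum _ fun i _ => (hR.isDensityFamily j).integrable i]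
  simp only [(hR.isDensityFamily j).integral_eq_one, Finset.sum_const, Finset.card_univ,
    nsmul_eq_mul, mul_one]
  exact inv_mul_cancel₀ hR.card_pos.ne'

lemma ae_eq [CompleteSpace H] {Y : Fin n → H}
    {f g : ∀ j, EuclideanSpace ℝ (Fin (L j)) → H}
    (hf : IsSolution D K h ξ Y f) (hg : IsSolution D K h ξ Y g)
    (hf' : SatisfiesConstraints D K h ξ f) (hg' : SatisfiesConstraints D K h ξ g)
    (hcov : ∀ x ∈ domain D, ∃ i, ξ i ∈ domain D ∧ ∀ j, ξ i j ∈ Metric.ball (x j) (h j))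
    (j : Fin d) : ∀ᵐ x ∂(volume.restrict (D j)), f j x = g j x := by
  obtain ⟨c, h0, hc⟩ := hR.exists_sub_eq_const hf hg
  let S : ∀ j, Set (EuclideanSpace ℝ (Fin (L j))) := fun j =>
    {x | x ∈ D j ∧ ∀ i, weight D K h ξ j i x ≠ 0 → f j x - g j x = c j i}
  have hS : ∀ j, ∀ᵐ x ∂(volume.restrict (D j)), x ∈ S j := fun j =>
    (ae_restrict_mem (hR.measurableSet j)).and (hc j)
  -- A set of full measure in `D j` is nonempty because `D j` has positive measure; this supplies
  -- the base point `z` for separating the variables.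
  have hex : ∀ j, ∃ x, x ∈ S j := fun j => by
    have : NeZero (volume.restrict (D j)) :=
      ⟨fun h0 => (hR.volume_pos j).ne' (Measure.restrict_eq_zero.1 h0)⟩
    exact (hS j).exists
  choose z hz using hex
  have hsum : ∀ x ∈ Set.univ.pi S, ∑ j, (f j (x j) - g j (x j)) = 0 := fun x hx => by
    obtain ⟨i, hi, hball⟩ := hcov x fun j hj => (hx j hj).1
    refine Eq.trans (Finset.sum_congr rfl fun j _ => ?_) (h0 ⟨i, hi⟩)
    exact (hx j (Set.mem_univ j)).2 ⟨i, hi⟩ (hR.weight_pos (i := ⟨i, hi⟩) (hball j)).ne'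
  have hconst : ∀ᵐ x ∂(volume.restrict (D j)), f j x - g j x = f j (z j) - g j (z j) :=
    (hS j).mono fun x hx =>
      eq_of_sum_eq_zero_on_pi (F := fun j x => f j x - g j x) hsum (fun k _ => hz k) hx
  -- Since `pHat1` has mass one, the constant equals the weighted mean of the difference, which the
  -- constraints make zero.
  have hmean : f j (z j) - g j (z j) = 0 := by
    calc f j (z j) - g j (z j)
        = ∫ x in D j, pHat1 D K h ξ j x • (f j (z j) - g j (z j)) := by
          rw [integral_smul_const, hR.integral_pHat1, one_smul]
      _ = ∫ x in D j, (pHat1 D K h ξ j x • f j x - pHat1 D K h ξ j x • g j x) :=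
          integral_congr_ae (by
            filter_upwards [hconst] with x hx
            rw [← hx, smul_sub])
      _ = 0 := by
          rw [integral_sub (hf'.integrable j) (hg'.integrable j), hf'.centered, hg'.centered,
            sub_zero]
  filter_upwards [hconst] with x hx
  exact sub_eq_zero.1 (hx.trans hmean)

end Admissible

end Model

end SBF

theorem proposition4 {d n : ℕ} {L : Fin d → ℕ}
    {H : Type*} [NormedAddCommGroup H] [InnerProductSpace ℝ H] [CompleteSpace H]
    [TopologicalSpace.SeparableSpace H]
    (D : ∀ j, Set (EuclideanSpace ℝ (Fin (L j))))
    (hD_compact : ∀ j, IsCompact (D j)) (hD_pos : ∀ j, 0 < MeasureTheory.volume (D j))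
    (K : Fin d → ℝ → ℝ) (hK_cont : ∀ j, ContinuousOn (K j) (Set.Ici 0))
    (hK_pos : ∀ j, ∀ t ∈ Set.Ico (0 : ℝ) 1, 0 < K j t)
    (hK_zero : ∀ j, ∀ t ∈ Set.Ici (1 : ℝ), K j t = 0)
    (h : Fin d → ℝ) (hh : ∀ j, 0 < h j)
    (ξ : Fin n → ∀ j, EuclideanSpace ℝ (Fin (L j))) (Y : Fin n → H)
    (hobs : ∃ i, ξ i ∈ SBF.domain D)
    (hA : SBF.ConditionA D h ξ) :
    (∃ f : ∀ j, EuclideanSpace ℝ (Fin (L j)) → H,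
      SBF.IsSolution D K h ξ Y f ∧ SBF.SatisfiesConstraints D K h ξ f) ∧
    (∀ f g : ∀ j, EuclideanSpace ℝ (Fin (L j)) → H,
      SBF.IsSolution D K h ξ Y f → SBF.IsSolution D K h ξ Y g →
      ∀ᵐ x ∂(SBF.PHat D K h ξ), ∑ j, f j (x j) = ∑ j, g j (x j)) ∧
    (∀ f g : ∀ j, EuclideanSpace ℝ (Fin (L j)) → H,
      SBF.IsSolution D K h ξ Y f → SBF.IsSolution D K h ξ Y g →
      SBF.SatisfiesConstraints D K h ξ f → SBF.SatisfiesConstraints D K h ξ g →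
      (∀ x ∈ SBF.domain D, ∃ i, ξ i ∈ SBF.domain D ∧ ∀ j, ξ i j ∈ Metric.ball (x j) (h j)) →
      ∀ j, ∀ᵐ x ∂(MeasureTheory.volume.restrict (D j)), f j x = g j x) := by
  have hR : SBF.Admissible D K h ξ :=
    ⟨hD_compact, hD_pos, hK_cont, hK_pos, hK_zero, hh, hobs.elim fun i hi => ⟨⟨i, hi⟩⟩, hA⟩
  exact ⟨hR.exists_solution Y, fun _ _ hf hg => hR.ae_sum_eq hf hg,
    fun _ _ hf hg hf' hg' hcov => hR.ae_eq hf hg hf' hg' hcov⟩
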